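/- Let $T$ be a rooted ordered tree with $n \ge 1$ nodes: a finite tree with a distinguished root in which, for each node, a left-to-right linear order of its children is specified. A straight-line drawing $\Gamma$ of $T$ maps each node to a point of the plane and each edge to the straight-line segment between the points of its end-nodes. It is a grid drawing if all nodes have integer coordinates; planar if distinct nodes are at distinct points and no two edges intersect except at common end-points; strictly-upward if each node lies strictly below its parent ($y_\Gamma(u) < y_\Gamma(p(u))$); and a strictly-upward drawing is order-preserving if, for each node $u$, the edges from $u$ to its children enter $u$ in the prescribed left-to-right order. The width $w(\Gamma)$ (height $h(\Gamma)$) of a grid drawing is the number of grid columns (rows), i.e. vertical (horizontal) lines with integer coordinate, that intersect its bounding box. Let $\Gamma_0$ and $\Gamma_1$ be two order-preserving strictly-upward straight-line planar grid drawings of $T$. Then there is a $(2n-1)$-step upward planar morph $\mathcal M=\langle \Gamma_0=\Delta_0,\Delta_1,\dots,\Delta_{2n-1}=\Gamma_1\rangle$ such that $$h(\mathcal M)=\max\{h(\Gamma_0),h(\Gamma_1)\},\qquad w(\mathcal M)=\max\{w(\Gamma_0),w(\Gamma_1)\}+n-1 .$$ Here the $\Delta_i$ are straight-line grid drawings of $T$;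 the morph is planar and upward if for every $1\le i\le 2n-1$ and every $t\in[0,1]$ the straight-line drawing that places each node $v$ at $(1-t)\Delta_{i-1}(v)+t\,\Delta_i(v)$ is planar and strictly-upward; and $h(\mathcal M)=\max_{0\le i\le 2n-1} h(\Delta_i)$, $w(\mathcal M)=\max_{0\le i\le 2n-1} w(\Delta_i)$. -/

import Mathlib

/-- In the graph `G` rooted at `r`, the node `p` is the parent of `u`: it is adjacent to `u` and it
lies on the path from `u` to `r`. (For `u = r` that path is trivial, so the root has no parent.) -/
def SimpleGraph.IsParentOf {V : Type*} (G : SimpleGraph V) (r p u : V) : Prop :=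
  G.Adj u p ∧ ∃ w : G.Walk u r, w.IsPath ∧ p ∈ w.support

/-- A rooted ordered tree with node set `V`: a tree, a root, and for each node the list of its
children in left-to-right order. -/
structure RootedOrderedTree (V : Type*) where
  graph : SimpleGraph V
  isTree : graph.IsTree
  root : V
  children : V → List V
  nodup_children : ∀ u, (children u).Nodup
  mem_children : ∀ u v, v ∈ children u ↔ graph.IsParentOf root u v

/-- A straight-line drawing with node set `V`, given by the positions of the nodes; an edge `ab` is
represented by the segment `segment ℝ (Γ a) (Γ b)`. -/
abbrev Drawing (V : Type*) := V → ℝ × ℝ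

namespace Drawing

/-- The nodes have integer coordinates. -/
def IsGrid {V : Type*} (Γ : Drawing V) : Prop :=
  ∀ v, ∃ x y : ℤ, Γ v = ((x : ℝ), (y : ℝ))

/-- Distinct nodes lie at distinct points, and distinct edges meet only at the points that represent
their common end-nodes. -/
def IsPlanar {V : Type*} (T : RootedOrderedTree V) (Γ : Drawing V) : Prop :=
  Function.Injective Γ ∧
    ∀ a b c d, T.graph.Adj a b → T.graph.Adj c d → s(a, b) ≠ s(c, d) →
      segment ℝ (Γ a) (Γ b) ∩ segment ℝ (Γ c) (Γ d) ⊆ Γ '' (({a, b} : Set V) ∩ {c, d})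

/-- Each node lies strictly below its parent. -/
def IsStrictlyUpward {V : Type*} (T : RootedOrderedTree V) (Γ : Drawing V) : Prop :=
  ∀ p u, T.graph.IsParentOf T.root p u → (Γ u).2 < (Γ p).2

/-- For points `a`, `b` below `u`, the segment `ua` enters `u` to the left of the segment `ub`:
the turn from direction `a - u` to direction `b - u` is counter-clockwise. -/
def EntersLeftOf (u a b : ℝ × ℝ) : Prop :=
  0 < (a.1 - u.1) * (b.2 - u.2) - (a.2 - u.2) * (b.1 - u.1)

/-- The edges from each node to its children enter the node in the prescribed left-to-right order.
(This is the meaning of order-preserving for strictly-upward drawings.) -/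
def IsOrderPreserving {V : Type*} (T : RootedOrderedTree V) (Γ : Drawing V) : Prop :=
  ∀ u, (T.children u).Pairwise fun a b => EntersLeftOf (Γ u) (Γ a) (Γ b)

/-- The smallest axis-parallel rectangle that contains the drawing (of a finite nonempty graph). -/
noncomputable def boundingBox {V : Type*} (Γ : Drawing V) : Set (ℝ × ℝ) :=
  Set.Icc (⨅ v, (Γ v).1, ⨅ v, (Γ v).2) (⨆ v, (Γ v).1, ⨆ v, (Γ v).2)

/-- The number of grid columns that intersect the bounding box. -/
noncomputable def width {V : Type*} (Γ : Drawing V) : ℕ :=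
  {k : ℤ | ∃ y : ℝ, ((k : ℝ), y) ∈ Γ.boundingBox}.ncard

/-- The number of grid rows that intersect the bounding box. -/
noncomputable def height {V : Type*} (Γ : Drawing V) : ℕ :=
  {k : ℤ | ∃ x : ℝ, (x, (k : ℝ)) ∈ Γ.boundingBox}.ncard

/-- The drawing at time `t` of the linear morph from `Γ` to `Γ'`. -/
def linearMorph {V : Type*} (Γ Γ' : Drawing V) (t : ℝ) : Drawing V :=
  fun v => (1 - t) • Γ v + t • Γ' v

end Drawing

/-- A `k`-step piecewise-linear morph is the sequence of its drawings `Δ₀, …, Δₖ`; consecutive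
drawings are joined by linear morphs. -/
abbrev Morph (V : Type*) (k : ℕ) := Fin (k + 1) → Drawing V

namespace Morph

/-- Every drawing of every step is planar. -/
def IsPlanar {V : Type*} {k : ℕ} (T : RootedOrderedTree V) (Δ : Morph V k) : Prop :=
  ∀ i : Fin k, ∀ t ∈ Set.Icc (0 : ℝ) 1,
    ((Δ i.castSucc).linearMorph (Δ i.succ) t).IsPlanar T

/-- Every drawing of every step is strictly-upward. -/
def IsUpward {V : Type*} {k : ℕ} (T : RootedOrderedTree V) (Δ : Morph V k) : Prop :=
  ∀ i : Fin k, ∀ t ∈ Set.Icc (0 : ℝ) 1,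
    ((Δ i.castSucc).linearMorph (Δ i.succ) t).IsStrictlyUpward T

/-- The maximum of the widths of `Δ₀, …, Δₖ`. -/
noncomputable def width {V : Type*} {k : ℕ} (Δ : Morph V k) : ℕ :=
  Finset.univ.sup fun i => (Δ i).width

/-- The maximum of the heights of `Δ₀, …, Δₖ`. -/
noncomputable def height {V : Type*} {k : ℕ} (Δ : Morph V k) : ℕ :=
  Finset.univ.sup fun i => (Δ i).height

end Morph

/-! ### Parents, addresses and the preorder. -/

namespace RootedOrderedTree

variable {V : Type*} (T : RootedOrderedTree V)

/-! Both drawings are morphed to a canonical shape in which every node except the root hangs one row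
below its parent, the node of preorder rank `r` in column `R + r`, where `R` bounds the abscissas of
the original drawing. `stage Γ R k` is the intermediate drawing in which the ranks below `k` (and
the root) are as in `Γ` and the other nodes hang. Passing from `k = n` down to `k = 1` takes `n - 1`
steps, one more step joins the two canonical drawings, and `n - 1` steps, run backwards, lead to
`Γ₁`: this makes `2n - 1`.

Planarity is handled through `IsOrdered`: edges on diverging root paths keep their left-to-right
order at each common height. For strictly upward drawings this implies planarity
(`IsOrdered.isPlanar`), and the given drawings have it (`isOrdered_of_isPlanar`). In the step from
`k + 1` to `k`, the node of rank `k` moves on a segment and the later nodes hang at every time, so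
`isOrdered_of_hanging` applies to every intermediate drawing. Its inputs are that the moving edge
turns only to the right, away from the edges on its left, and that nodes of a grid drawing can be
joined to points one row below and far to the right without hitting edges on their left
(`edgeX_lt_of_isGrid`).

Hanging costs one row per edge, the least a strictly upward grid drawing can spend, so heights do
not grow. The width is made exact by the choice of `R` in `exists_width_stage`. -/

theorem not_isParentOf_root (p : V) : ¬ T.graph.IsParentOf T.root p T.root := by
  rintro ⟨hadj, w, hw, hp⟩
  obtain rfl := SimpleGraph.Walk.eq_nil_iff_nil.2 (SimpleGraph.Walk.isPath_iff_nil.1 hw)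
  simp only [SimpleGraph.Walk.support_nil, List.mem_singleton] at hp
  subst hp
  exact T.graph.irrefl hadj

/-- The path from a node to the root. -/
noncomputable def rootPath (v : V) : T.graph.Walk v T.root :=
  (T.isTree.existsUnique_path v T.root).choose

theorem rootPath_isPath (v : V) : (T.rootPath v).IsPath :=
  (T.isTree.existsUnique_path v T.root).choose_spec.1

theorem eq_rootPath {v : V} {w : T.graph.Walk v T.root} (hw : w.IsPath) : w = T.rootPath v :=
  (T.isTree.existsUnique_path v T.root).choose_spec.2 w hw

/-- The number of edges on the path from a node to the root. -/
noncomputable def depth (v : V) : ℕ := (T.rootPath v).length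

-- Paths in a tree are unique, so a neighbour of `u` on the path to the root must be its second
-- node.
open Classical in
theorem isParentOf_iff_exists_rootPath_eq {p u : V} :
    T.graph.IsParentOf T.root p u ↔
      ∃ h : T.graph.Adj u p, T.rootPath u = .cons h (T.rootPath p) := by
  constructor
  · rintro ⟨hadj, w, hw, hp⟩
    refine ⟨hadj, ?_⟩
    rw [← T.eq_rootPath (hw.dropUntil hp), ← T.eq_rootPath hw]
    have h1 : w.takeUntil p hp = .cons hadj .nil :=
      (T.isTree.existsUnique_path u p).unique (hw.takeUntil hp)
        (by simpa using hadj.ne)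
    conv_lhs => rw [← w.take_spec hp, h1]
    simp
  · rintro ⟨h, he⟩
    exact ⟨h, T.rootPath u, T.rootPath_isPath u, by rw [he]; simp⟩

theorem exists_isParentOf {u : V} (hu : u ≠ T.root) : ∃ p, T.graph.IsParentOf T.root p u := by
  rcases h : T.rootPath u with _ | ⟨hadj, w⟩
  · exact absurd rfl hu
  · refine ⟨_, T.isParentOf_iff_exists_rootPath_eq.2 ⟨hadj, ?_⟩⟩
    have := T.rootPath_isPath u
    rw [h, SimpleGraph.Walk.cons_isPath_iff] at this
    rw [h, T.eq_rootPath this.1]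

open Classical in
/-- The parent of a node; the root is its own parent. -/
noncomputable def par (u : V) : V :=
  if h : u ≠ T.root then (T.exists_isParentOf h).choose else T.root

@[simp] theorem par_root : T.par T.root = T.root := by simp [par]

theorem isParentOf_par {u : V} (hu : u ≠ T.root) : T.graph.IsParentOf T.root (T.par u) u := by
  rw [par, dif_pos hu]
  exact (T.exists_isParentOf hu).choose_spec

theorem isParentOf_iff {p u : V} :
    T.graph.IsParentOf T.root p u ↔ u ≠ T.root ∧ p = T.par u := by
  constructor
  · intro h
    have hu : u ≠ T.root := by rintro rfl; exact T.not_isParentOf_root _ h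
    refine ⟨hu, ?_⟩
    obtain ⟨h1, e1⟩ := T.isParentOf_iff_exists_rootPath_eq.1 h
    obtain ⟨h2, e2⟩ := T.isParentOf_iff_exists_rootPath_eq.1 (T.isParentOf_par hu)
    rw [e1] at e2
    injection e2
  · rintro ⟨hu, rfl⟩
    exact T.isParentOf_par hu

theorem depth_par {u : V} (hu : u ≠ T.root) : T.depth u = T.depth (T.par u) + 1 := by
  obtain ⟨_, e⟩ := T.isParentOf_iff_exists_rootPath_eq.1 (T.isParentOf_par hu)
  rw [depth, e, SimpleGraph.Walk.length_cons, depth]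

theorem depth_par_lt {u : V} (hu : u ≠ T.root) : T.depth (T.par u) < T.depth u := by
  rw [T.depth_par hu]; exact Nat.lt_succ_self _

/-- Induction from the root towards the leaves. -/
theorem par_induction {P : V → Prop} (root : P T.root)
    (step : ∀ v, v ≠ T.root → P (T.par v) → P v) (v : V) : P v := by
  induction hd : T.depth v using Nat.strong_induction_on generalizing v with
  | _ d ih =>
    by_cases hv : v = T.root
    · rw [hv]; exact root
    · exact step v hv (ih _ (hd ▸ T.depth_par_lt hv) _ rfl)

theorem adj_iff {a b : V} :
    T.graph.Adj a b ↔ (b ≠ T.root ∧ a = T.par b) ∨ (a ≠ T.root ∧ b = T.par a) := by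
  rw [← T.isParentOf_iff, ← T.isParentOf_iff]
  constructor
  · intro h
    -- If `a` is not on the path from `b` to the root, then prefixing `a` to that path gives the one
    -- from `a`.
    by_cases ha : a ∈ (T.rootPath b).support
    · exact Or.inl ⟨h.symm, _, T.rootPath_isPath b, ha⟩
    · refine Or.inr ⟨h, .cons h (T.rootPath b), ?_, by simp⟩
      rw [SimpleGraph.Walk.cons_isPath_iff]
      exact ⟨T.rootPath_isPath b, ha⟩
  · rintro (h | h)
    · exact h.1.symm
    · exact h.1

theorem mem_children_par {v : V} (hv : v ≠ T.root) : v ∈ T.children (T.par v) :=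
  (T.mem_children _ _).2 (T.isParentOf_par hv)

open Classical in
/-- The positions, in the lists of children, of the nodes on the path from the root to a node. -/
noncomputable def addr (v : V) : List ℕ :=
  if _h : v = T.root then [] else addr (T.par v) ++ [(T.children (T.par v)).idxOf v]
termination_by T.depth v
decreasing_by exact T.depth_par_lt _h

@[simp] theorem addr_root : T.addr T.root = [] := by
  rw [addr, dif_pos rfl]

open Classical in
theorem addr_eq {v : V} (hv : v ≠ T.root) :
    T.addr v = T.addr (T.par v) ++ [(T.children (T.par v)).idxOf v] := by
  rw [addr, dif_neg hv]

open Classical in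
theorem addr_injective : Function.Injective T.addr := by
  intro u
  refine T.par_induction (P := fun u => ∀ v, T.addr u = T.addr v → u = v) ?_ ?_ u
  · intro v h
    by_contra hv
    rw [T.addr_eq (Ne.symm hv)] at h
    simp at h
  · intro u hu ih v h
    by_cases hv : v = T.root
    · rw [T.addr_eq hu, hv] at h
      simp at h
    · rw [T.addr_eq hu, T.addr_eq hv] at h
      obtain ⟨h1, h2⟩ := List.append_inj' h rfl
      have h3 := ih _ h1
      rw [h3] at h2
      refine (List.idxOf_inj (h3 ▸ T.mem_children_par hu)).1 ?_
      simpa using h2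

/-- The node `u` is an ancestor of `v`, or `v` itself. -/
def Anc (u v : V) : Prop := T.addr u <+: T.addr v

/-- The paths from the root to `u` and to `v` diverge, and the former does so to the left. -/
def LeftOf (u v : V) : Prop :=
  ∃ l i j s t, i < j ∧ T.addr u = l ++ i :: s ∧ T.addr v = l ++ j :: t

variable {T}

theorem Anc.eq_or_par {u v : V} (h : T.Anc u v) : u = v ∨ (v ≠ T.root ∧ T.Anc u (T.par v)) := by
  by_cases hv : v = T.root
  · left
    subst hv
    apply T.addr_injective
    simpa [Anc] using h
  · rw [Anc, T.addr_eq hv, List.prefix_concat_iff, ← T.addr_eq hv] at h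
    rcases h with h | h
    · exact Or.inl (T.addr_injective h)
    · exact Or.inr ⟨hv, h⟩

theorem LeftOf.left_ne_root {u v : V} (h : T.LeftOf u v) : u ≠ T.root := by
  rintro rfl
  obtain ⟨l, i, j, s, t, -, h, -⟩ := h
  simp at h

theorem LeftOf.right_ne_root {u v : V} (h : T.LeftOf u v) : v ≠ T.root := by
  rintro rfl
  obtain ⟨l, i, j, s, t, -, -, h⟩ := h
  simp at h

/-- Two addresses are comparable as prefixes or differ at a first place; every case distinction on
pairs of edges rests on this. -/
theorem anc_or_leftOf (u v : V) : T.Anc u v ∨ T.Anc v u ∨ T.LeftOf u v ∨ T.LeftOf v u := by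
  unfold Anc LeftOf
  generalize T.addr u = a
  generalize T.addr v = b
  induction a generalizing b with
  | nil => exact Or.inl List.nil_prefix
  | cons i a ih =>
    rcases b with _ | ⟨j, b⟩
    · exact Or.inr (Or.inl List.nil_prefix)
    · rcases lt_trichotomy i j with h | rfl | h
      · exact Or.inr (Or.inr (Or.inl ⟨[], i, j, a, b, h, rfl, rfl⟩))
      · rcases ih b with h | h | ⟨l, i', j', s, t, h, rfl, rfl⟩ | ⟨l, i', j', s, t, h, rfl, rfl⟩
        · exact Or.inl ((List.prefix_cons_inj i).2 h)
        · exact Or.inr (Or.inl ((List.prefix_cons_inj i).2 h))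
        · exact Or.inr (Or.inr (Or.inl ⟨i :: l, i', j', s, t, h, rfl, rfl⟩))
        · exact Or.inr (Or.inr (Or.inr ⟨i :: l, i', j', s, t, h, rfl, rfl⟩))
      · exact Or.inr (Or.inr (Or.inr ⟨[], j, i, b, a, h, rfl, rfl⟩))

theorem LeftOf.not_anc {u v : V} (h : T.LeftOf u v) : ¬ T.Anc u v := by
  obtain ⟨l, i, j, s, t, hij, hu, hv⟩ := h
  rw [Anc, hu, hv, List.prefix_append_right_inj, List.cons_prefix_cons]
  exact fun h => hij.ne h.1

theorem LeftOf.not_anc' {u v : V} (h : T.LeftOf u v) : ¬ T.Anc v u := by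
  obtain ⟨l, i, j, s, t, hij, hu, hv⟩ := h
  rw [Anc, hu, hv, List.prefix_append_right_inj, List.cons_prefix_cons]
  exact fun h => hij.ne' h.1

theorem anc_par (u : V) : T.Anc (T.par u) u := by
  by_cases hu : u = T.root
  · simp [hu, Anc]
  · rw [Anc, T.addr_eq hu]; exact List.prefix_append _ _

theorem addr_cases {v : V} {l t : List ℕ} {j : ℕ} (hv : T.addr v = l ++ j :: t) :
    (T.addr (T.par v) = l ∧ t = []) ∨ ∃ t', T.addr (T.par v) = l ++ j :: t' := by
  have hv' : v ≠ T.root := by rintro rfl; simp at hv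
  rw [T.addr_eq hv'] at hv
  rcases List.eq_nil_or_concat t with rfl | ⟨t', c, rfl⟩
  · exact Or.inl ⟨(List.append_inj' hv rfl).1, rfl⟩
  · right
    refine ⟨t', ?_⟩
    have : l ++ j :: (t' ++ [c]) = (l ++ j :: t') ++ [c] := by simp
    rw [List.concat_eq_append, this] at hv
    exact (List.append_inj' hv rfl).1

/-- Either `v` lies strictly beyond the child of the branching node, and its parent is still on the
right branch, or its parent is the branching node itself, which is above or equal to the parent of
`u`. -/
theorem LeftOf.par_right {u v : V} (h : T.LeftOf u v) :
    T.LeftOf u (T.par v) ∨ T.Anc (T.par v) (T.par u) := by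
  obtain ⟨l, i, j, s, t, hij, hu, hv⟩ := h
  rcases addr_cases hv with ⟨h, -⟩ | ⟨t', h⟩
  · right
    rcases addr_cases hu with ⟨h', -⟩ | ⟨t', h'⟩
    · rw [Anc, h, h']
    · rw [Anc, h, h']; exact List.prefix_append _ _
  · exact Or.inl ⟨l, i, j, s, t', hij, hu, h⟩

theorem LeftOf.par_left {u v : V} (h : T.LeftOf u v) :
    T.LeftOf (T.par u) v ∨ T.Anc (T.par u) (T.par v) := by
  obtain ⟨l, i, j, s, t, hij, hu, hv⟩ := h
  rcases addr_cases hu with ⟨h, -⟩ | ⟨t', h⟩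
  · right
    rcases addr_cases hv with ⟨h', -⟩ | ⟨t', h'⟩
    · rw [Anc, h, h']
    · rw [Anc, h, h']; exact List.prefix_append _ _
  · exact Or.inl ⟨l, i, j, t', t, hij, h, hv⟩

/-- The lexicographic order on addresses is the preorder: it puts left branches before right ones
and, by `addr_par_lt`, parents before children. -/
theorem LeftOf.addr_lt {u v : V} (h : T.LeftOf u v) : T.addr u < T.addr v := by
  obtain ⟨l, i, j, s, t, hij, hu, hv⟩ := h
  rw [hu, hv]
  exact List.append_left_lt (List.cons_lt_cons_iff.2 (Or.inl hij))

theorem addr_par_lt {u : V} (hu : u ≠ T.root) : T.addr (T.par u) < T.addr u := by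
  rw [T.addr_eq hu]
  conv_lhs => rw [← List.append_nil (T.addr (T.par u))]
  exact List.append_left_lt (List.nil_lt_cons _ _)

theorem LeftOf.entersLeftOf {Γ : Drawing V} (hΓ : Γ.IsOrderPreserving T) {u v : V}
    (h : T.LeftOf u v) (hp : T.par u = T.par v) :
    Drawing.EntersLeftOf (Γ (T.par u)) (Γ u) (Γ v) := by
  classical
  have hl := h.addr_lt
  have mu := T.mem_children_par h.left_ne_root
  have mv := T.mem_children_par h.right_ne_root
  rw [T.addr_eq h.left_ne_root, T.addr_eq h.right_ne_root, ← hp] at hl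
  rw [← hp] at mv
  have hlt : (T.children (T.par u)).idxOf u < (T.children (T.par u)).idxOf v := by
    by_contra hc
    refine absurd hl (not_lt.2 ?_)
    rcases (not_lt.1 hc).lt_or_eq with hc | hc
    · exact (List.append_left_lt (List.cons_lt_cons_iff.2 (Or.inl hc))).le
    · rw [hc]
  have := List.pairwise_iff_getElem.1 (hΓ (T.par u)) _ _ (List.idxOf_lt_length_iff.2 mu)
    (List.idxOf_lt_length_iff.2 mv) hlt
  simpa using this

variable (T)

/-- The position of a node in the preorder traversal. -/
noncomputable def rank [Fintype V] (v : V) : ℕ :=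
  (Finset.univ.filter fun u => T.addr u < T.addr v).card

variable {T}

theorem rank_lt_rank [Fintype V] {u v : V} (h : T.addr u < T.addr v) : T.rank u < T.rank v := by
  apply Finset.card_lt_card
  rw [Finset.ssubset_iff_of_subset]
  · exact ⟨u, by simpa using h, by simp⟩
  · intro w
    simp only [Finset.mem_filter, Finset.mem_univ, true_and]
    exact fun hw => hw.trans h

theorem LeftOf.rank_lt [Fintype V] {u v : V} (h : T.LeftOf u v) : T.rank u < T.rank v :=
  rank_lt_rank h.addr_lt

theorem rank_par_lt [Fintype V] {u : V} (h : u ≠ T.root) : T.rank (T.par u) < T.rank u :=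
  rank_lt_rank (addr_par_lt h)

theorem rank_lt_card [Fintype V] (v : V) : T.rank v < Fintype.card V :=
  Finset.card_lt_univ_of_notMem (x := v) (by simp)

theorem rank_injective [Fintype V] : Function.Injective T.rank := by
  intro u v h
  rcases lt_trichotomy (T.addr u) (T.addr v) with h' | h' | h'
  · exact absurd h (rank_lt_rank h').ne
  · exact T.addr_injective h'
  · exact absurd h (rank_lt_rank h').ne'

theorem exists_rank_eq [Fintype V] {k : ℕ} (hk : k < Fintype.card V) : ∃ v, T.rank v = k := by
  have hinj : Function.Injective fun v => (⟨T.rank v, rank_lt_card v⟩ : Fin (Fintype.card V)) :=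
    fun u v h => rank_injective (Fin.mk.inj_iff.1 h)
  obtain ⟨v, hv⟩ := ((Fintype.bijective_iff_injective_and_card _).2 ⟨hinj, by simp⟩).2 ⟨k, hk⟩
  exact ⟨v, Fin.mk.inj_iff.1 hv⟩

@[simp] theorem rank_root [Fintype V] : T.rank T.root = 0 := by
  simp [rank]

theorem rank_pos [Fintype V] {v : V} (hv : v ≠ T.root) : 0 < T.rank v :=
  (Nat.zero_le _).trans_lt (rank_par_lt hv)

end RootedOrderedTree

/-! ### Left-to-right order of edges at each height, and planarity. -/

namespace RootedOrderedTree

variable {V : Type*} (T : RootedOrderedTree V)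

/-- The abscissa, at height `h`, of the line through `v` and its parent. -/
noncomputable def edgeX (D : Drawing V) (v : V) (h : ℝ) : ℝ :=
  (D v).1 + ((D (T.par v)).1 - (D v).1) / ((D (T.par v)).2 - (D v).2) * (h - (D v).2)

/-- The heights that the edge from `v` to its parent covers. -/
def span (D : Drawing V) (v : V) : Set ℝ := Set.Icc (D v).2 (D (T.par v)).2

/-- Edges on diverging paths from the root keep, at each height, the order in which these paths
diverge. -/
def IsOrdered (D : Drawing V) : Prop :=
  ∀ u v, T.LeftOf u v → ∀ h ∈ T.span D u, h ∈ T.span D v →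
    T.edgeX D u h < T.edgeX D v h ∨ (T.par u = T.par v ∧ h = (D (T.par u)).2)

variable {T} {D : Drawing V}

theorem isStrictlyUpward_iff :
    D.IsStrictlyUpward T ↔ ∀ v, v ≠ T.root → (D v).2 < (D (T.par v)).2 := by
  simp only [Drawing.IsStrictlyUpward, T.isParentOf_iff]
  constructor
  · intro h v hv
    exact h _ v ⟨hv, rfl⟩
  · rintro h _ v ⟨hv, rfl⟩
    exact h v hv

@[simp] theorem edgeX_self (v : V) : T.edgeX D v (D v).2 = (D v).1 := by
  simp [edgeX]

theorem edgeX_par {v : V} (hv : (D v).2 < (D (T.par v)).2) :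
    T.edgeX D v (D (T.par v)).2 = (D (T.par v)).1 := by
  have : (D (T.par v)).2 - (D v).2 ≠ 0 := (sub_pos.2 hv).ne'
  rw [edgeX, div_mul_cancel₀ _ this]
  ring

theorem edgeX_convex (v : V) (a b s : ℝ) :
    T.edgeX D v ((1 - s) * a + s * b) = (1 - s) * T.edgeX D v a + s * T.edgeX D v b := by
  simp only [edgeX]; ring

theorem exists_convex {a b h : ℝ} (h1 : a ≤ h) (h2 : h ≤ b) :
    ∃ s, 0 ≤ s ∧ s ≤ 1 ∧ h = (1 - s) * a + s * b := by
  rcases (h1.trans h2).eq_or_lt with rfl | hab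
  · exact ⟨0, le_rfl, zero_le_one, by linarith⟩
  · have : 0 < b - a := sub_pos.2 hab
    refine ⟨(h - a) / (b - a), div_nonneg (by linarith) this.le, ?_, ?_⟩
    · rw [div_le_one this]; linarith
    · field_simp; ring

theorem mem_segment_iff {v : V} (hv : (D v).2 < (D (T.par v)).2) (q : ℝ × ℝ) :
    q ∈ segment ℝ (D v) (D (T.par v)) ↔ q.2 ∈ T.span D v ∧ q.1 = T.edgeX D v q.2 := by
  rw [segment_eq_image]
  constructor
  · rintro ⟨s, ⟨hs0, hs1⟩, rfl⟩
    have e : ((1 - s) • D v + s • D (T.par v)).2 = (1 - s) * (D v).2 + s * (D (T.par v)).2 := by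
      simp
    refine ⟨?_, ?_⟩
    · simp only [e, span, Set.mem_Icc]
      constructor <;> nlinarith
    · simp only [e]
      rw [edgeX_convex, edgeX_self, edgeX_par hv]
      simp
  · rintro ⟨⟨h1, h2⟩, h3⟩
    obtain ⟨s, hs0, hs1, hs⟩ := exists_convex h1 h2
    refine ⟨s, ⟨hs0, hs1⟩, Prod.ext ?_ ?_⟩
    · rw [h3, hs, edgeX_convex, edgeX_self, edgeX_par hv]
      simp
    · rw [hs]; simp

theorem Anc.snd_le (hD : ∀ v, v ≠ T.root → (D v).2 < (D (T.par v)).2) {a b : V}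
    (h : T.Anc a b) : (D b).2 ≤ (D a).2 := by
  induction b using T.par_induction with
  | root =>
    rcases h.eq_or_par with rfl | h
    · exact le_rfl
    · exact absurd rfl h.1
  | step v hv ih =>
    rcases h.eq_or_par with rfl | ⟨-, h⟩
    · exact le_rfl
    · exact (hD v hv).le.trans (ih h)

theorem Anc.snd_le_sub_one (hD : ∀ v, v ≠ T.root → (D v).2 ≤ (D (T.par v)).2 - 1) {a b : V}
    (h : T.Anc a b) (hab : a ≠ b) : (D b).2 ≤ (D a).2 - 1 := by
  rcases h.eq_or_par with rfl | ⟨hb, h⟩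
  · exact absurd rfl hab
  · have := h.snd_le (D := D) fun v hv => (hD v hv).trans_lt (sub_one_lt _)
    linarith [hD b hb]

theorem Anc.eq_of_snd_le (hD : ∀ v, v ≠ T.root → (D v).2 < (D (T.par v)).2) {a b : V}
    (h : T.Anc a b) (hab : (D a).2 ≤ (D b).2) : a = b := by
  rcases h.eq_or_par with rfl | ⟨hb, h⟩
  · rfl
  · linarith [hD b hb, h.snd_le hD]

/-- If `u` is a proper ancestor of `v`, the edges above them share a height only when `u` is the
parent of `v`, at `u` itself. On diverging branches the order separates them, except at the top of
sibling edges, which is the common parent. -/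
theorem IsOrdered.isPlanar (hD : ∀ v, v ≠ T.root → (D v).2 < (D (T.par v)).2)
    (h : T.IsOrdered D) : D.IsPlanar T := by
  have key : ∀ u v, T.LeftOf u v → D u ≠ D v := by
    intro u v huv e
    have hu := hD u huv.left_ne_root
    have hv := hD v huv.right_ne_root
    rcases h u v huv (D u).2 ⟨le_rfl, hu.le⟩ (by rw [e]; exact ⟨le_rfl, hv.le⟩) with h | h
    · rw [edgeX_self, e, edgeX_self] at h
      exact lt_irrefl _ h
    · exact hu.ne h.2
  have edge : ∀ u v, u ≠ T.root → v ≠ T.root → u ≠ v →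
      (T.Anc u v ∨ T.LeftOf u v) →
      segment ℝ (D u) (D (T.par u)) ∩ segment ℝ (D v) (D (T.par v)) ⊆
        D '' (({u, T.par u} : Set V) ∩ {v, T.par v}) := by
    rintro u v hu hv huv hr q ⟨hq1, hq2⟩
    rw [mem_segment_iff (hD u hu)] at hq1
    rw [mem_segment_iff (hD v hv)] at hq2
    rcases hr with hr | hr
    · rcases hr.eq_or_par with rfl | ⟨-, hr⟩
      · exact absurd rfl huv
      · obtain rfl := hr.eq_of_snd_le hD (hq1.1.1.trans hq2.1.2)
        refine ⟨T.par v, by simp, ?_⟩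
        have e : q.2 = (D (T.par v)).2 := le_antisymm hq2.1.2 hq1.1.1
        refine Prod.ext ?_ e.symm
        rw [hq1.2, e, edgeX_self]
    · rcases h u v hr q.2 hq1.1 hq2.1 with h | ⟨h1, h2⟩
      · rw [← hq1.2, ← hq2.2] at h
        exact absurd h (lt_irrefl _)
      · refine ⟨T.par u, by simp [h1], ?_⟩
        refine Prod.ext ?_ h2.symm
        rw [hq1.2, h2, edgeX_par (hD u hu)]
  have edge' : ∀ u v, u ≠ T.root → v ≠ T.root → u ≠ v →
      segment ℝ (D u) (D (T.par u)) ∩ segment ℝ (D v) (D (T.par v)) ⊆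
        D '' (({u, T.par u} : Set V) ∩ {v, T.par v}) := by
    intro u v hu hv huv
    rcases anc_or_leftOf (T := T) u v with h | h | h | h
    · exact edge u v hu hv huv (Or.inl h)
    · rw [Set.inter_comm, Set.inter_comm {u, T.par u}]
      exact edge v u hv hu huv.symm (Or.inl h)
    · exact edge u v hu hv huv (Or.inr h)
    · rw [Set.inter_comm, Set.inter_comm {u, T.par u}]
      exact edge v u hv hu huv.symm (Or.inr h)
  refine ⟨?_, ?_⟩
  · intro u v e
    rcases anc_or_leftOf (T := T) u v with h | h | h | h
    · exact h.eq_of_snd_le hD (by rw [e])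
    · exact (h.eq_of_snd_le hD (by rw [e])).symm
    · exact absurd e (key u v h)
    · exact absurd e.symm (key v u h)
  · intro a b c d hab hcd hne
    rw [T.adj_iff] at hab hcd
    rcases hab with ⟨hb, rfl⟩ | ⟨ha, rfl⟩ <;> rcases hcd with ⟨hd, rfl⟩ | ⟨hc, rfl⟩
    · rw [segment_symm, segment_symm ℝ (D (T.par d)), Set.pair_comm, Set.pair_comm _ d]
      exact edge' b d hb hd (by rintro rfl; exact hne rfl)
    · rw [segment_symm, Set.pair_comm]
      exact edge' b c hb hc (by rintro rfl; exact hne Sym2.eq_swap)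
    · rw [segment_symm ℝ (D (T.par d)), Set.pair_comm _ d]
      exact edge' a d ha hd (by rintro rfl; exact hne Sym2.eq_swap)
    · exact edge' a c ha hc (by rintro rfl; exact hne rfl)

theorem exists_edgeX_eq {v : V} (hv : (D v).2 < (D (T.par v)).2) {h : ℝ} (hh : h ∈ T.span D v) :
    ∃ s, 0 ≤ s ∧ s ≤ 1 ∧ h = (1 - s) * (D v).2 + s * (D (T.par v)).2 ∧
      T.edgeX D v h = (1 - s) * (D v).1 + s * (D (T.par v)).1 := by
  obtain ⟨s, hs0, hs1, hs⟩ := exists_convex hh.1 hh.2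
  refine ⟨s, hs0, hs1, hs, ?_⟩
  rw [hs, edgeX_convex, edgeX_self, edgeX_par hv]

theorem edgeX_lt {v : V} (hv : (D v).2 < (D (T.par v)).2) {h : ℝ} (hh : h ∈ T.span D v) {B : ℝ}
    (h1 : (D v).1 < B) (h2 : (D (T.par v)).1 < B) : T.edgeX D v h < B := by
  obtain ⟨s, hs0, hs1, -, e⟩ := exists_edgeX_eq hv hh
  rw [e]
  rcases hs0.eq_or_lt with rfl | hs0
  · simpa using h1
  · nlinarith

theorem edgeX_le {v : V} (hv : (D v).2 < (D (T.par v)).2) {h : ℝ} (hh : h ∈ T.span D v) {B : ℝ}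
    (h1 : (D v).1 ≤ B) (h2 : (D (T.par v)).1 ≤ B) : T.edgeX D v h ≤ B := by
  obtain ⟨s, hs0, hs1, -, e⟩ := exists_edgeX_eq hv hh
  rw [e]; nlinarith

theorem le_edgeX {v : V} (hv : (D v).2 < (D (T.par v)).2) {h : ℝ} (hh : h ∈ T.span D v) {B : ℝ}
    (h1 : B ≤ (D v).1) (h2 : B ≤ (D (T.par v)).1) : B ≤ T.edgeX D v h := by
  obtain ⟨s, hs0, hs1, -, e⟩ := exists_edgeX_eq hv hh
  rw [e]; nlinarith

/-- Two edges that do not meet keep their order over all common heights. -/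
theorem edgeX_lt_of_disjoint {u v : V} (hu : (D u).2 < (D (T.par u)).2)
    (hv : (D v).2 < (D (T.par v)).2)
    (hdisj : segment ℝ (D u) (D (T.par u)) ∩ segment ℝ (D v) (D (T.par v)) = ∅)
    {a b : ℝ} (hau : a ∈ T.span D u) (hav : a ∈ T.span D v) (hbu : b ∈ T.span D u)
    (hbv : b ∈ T.span D v) (ha : T.edgeX D u a < T.edgeX D v a) :
    T.edgeX D u b < T.edgeX D v b := by
  by_contra hb
  have hcont : ∀ w : V, Continuous (T.edgeX D w) := by
    intro w; unfold edgeX; fun_prop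
  obtain ⟨c, hc, he⟩ : ∃ c ∈ Set.uIcc a b, T.edgeX D u c - T.edgeX D v c = 0 := by
    exact intermediate_value_uIcc (f := fun c => T.edgeX D u c - T.edgeX D v c)
      ((hcont u).sub (hcont v)).continuousOn
      (Set.mem_uIcc.2 (Or.inl ⟨by linarith, by linarith⟩))
  have hcu := Set.ordConnected_Icc.uIcc_subset hau hbu hc
  have hcv := Set.ordConnected_Icc.uIcc_subset hav hbv hc
  have : (T.edgeX D u c, c) ∈
      segment ℝ (D u) (D (T.par u)) ∩ segment ℝ (D v) (D (T.par v)) :=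
    ⟨(mem_segment_iff hu _).2 ⟨hcu, rfl⟩, (mem_segment_iff hv _).2 ⟨hcv, sub_eq_zero.1 he⟩⟩
  rw [hdisj] at this
  exact this

/-- Sibling edges are ordered by their slopes. Other edges on diverging paths are disjoint and
cannot swap, so it suffices to compare them at the height of the lower parent. There one edge ends
at its parent, which is still on its own branch, and induction on the sum of depths applies to the
edge above that parent. -/
theorem isOrdered_of_isPlanar (hD : ∀ v, v ≠ T.root → (D v).2 < (D (T.par v)).2)
    (hp : D.IsPlanar T) (ho : D.IsOrderPreserving T) : T.IsOrdered D := by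
  intro u v huv
  induction hd : T.depth u + T.depth v using Nat.strong_induction_on generalizing u v with
  | _ d ih =>
    intro h hhu hhv
    have hur := huv.left_ne_root
    have hvr := huv.right_ne_root
    have hu := hD u hur
    have hv := hD v hvr
    by_cases hpar : T.par u = T.par v
    · rcases hhu.2.eq_or_lt with e | hlt
      · exact Or.inr ⟨hpar, e⟩
      · left
        have hent := huv.entersLeftOf ho hpar
        have hlt' := hlt
        unfold Drawing.EntersLeftOf at hent
        -- Measured downwards from the common parent, the abscissas are compared through the slopes,
        -- which `EntersLeftOf` orders.
        have e : ∀ w, (D w).2 < (D (T.par w)).2 → T.edgeX D w h = (D (T.par w)).1 +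
            ((D w).1 - (D (T.par w)).1) / ((D (T.par w)).2 - (D w).2) *
              ((D (T.par w)).2 - h) := by
          intro w hw
          have := (sub_pos.2 hw).ne'
          unfold edgeX
          field_simp
          ring
        rw [e u hu, e v hv, ← hpar]
        rw [← hpar] at hv
        have : ((D u).1 - (D (T.par u)).1) / ((D (T.par u)).2 - (D u).2) <
            ((D v).1 - (D (T.par u)).1) / ((D (T.par u)).2 - (D v).2) := by
          rw [div_lt_div_iff₀ (sub_pos.2 hu) (sub_pos.2 hv)]
          linarith
        have := mul_lt_mul_of_pos_right this (sub_pos.2 hlt)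
        linarith
    · left
      have hne : s(u, T.par u) ≠ s(v, T.par v) := by
        intro e
        rcases Sym2.eq_iff.1 e with ⟨rfl, -⟩ | ⟨e1, -⟩
        · exact hpar rfl
        · exact huv.not_anc (e1 ▸ anc_par v)
      have hdisj : segment ℝ (D u) (D (T.par u)) ∩ segment ℝ (D v) (D (T.par v)) = ∅ := by
        refine Set.subset_empty_iff.1 ((hp.2 _ _ _ _ (T.adj_iff.2 (Or.inr ⟨hur, rfl⟩))
          (T.adj_iff.2 (Or.inr ⟨hvr, rfl⟩)) hne).trans ?_)
        rintro _ ⟨w, ⟨h1, h2⟩, -⟩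
        simp only [Set.mem_insert_iff, Set.mem_singleton_iff] at h1 h2
        rcases h1 with rfl | rfl <;> rcases h2 with h2 | h2
        · subst h2; exact hpar rfl
        · exact huv.not_anc (h2 ▸ anc_par v)
        · exact huv.not_anc' (h2 ▸ anc_par u)
        · exact hpar h2
      rcases le_total (D (T.par u)).2 (D (T.par v)).2 with hle | hle
      · have hleft : T.LeftOf (T.par u) v := by
          rcases huv.par_left with h | h
          · exact h
          · exact absurd (h.eq_of_snd_le hD hle) hpar
        have hau : (D (T.par u)).2 ∈ T.span D u := ⟨hu.le, le_rfl⟩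
        have hav : (D (T.par u)).2 ∈ T.span D v := ⟨hhv.1.trans hhu.2, hle⟩
        refine edgeX_lt_of_disjoint hu hv hdisj hau hav hhu hhv ?_
        have hpu := hD _ hleft.left_ne_root
        rcases ih _ (by rw [← hd]; have := T.depth_par_lt hur; omega) _ _ hleft rfl
          (D (T.par u)).2 ⟨le_rfl, hpu.le⟩ hav with h | h
        · rwa [edgeX_self, ← edgeX_par hu] at h
        · exact absurd h.2 hpu.ne
      · have hright : T.LeftOf u (T.par v) := by
          rcases huv.par_right with h | h
          · exact h
          · exact absurd (h.eq_of_snd_le hD hle).symm hpar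
        have hav : (D (T.par v)).2 ∈ T.span D v := ⟨hv.le, le_rfl⟩
        have hau : (D (T.par v)).2 ∈ T.span D u := ⟨hhu.1.trans hhv.2, hle⟩
        refine edgeX_lt_of_disjoint hu hv hdisj hau hav hhu hhv ?_
        have hpv := hD _ hright.right_ne_root
        rcases ih _ (by rw [← hd]; have := T.depth_par_lt hvr; omega) _ _ hright rfl
          (D (T.par v)).2 hau ⟨le_rfl, hpv.le⟩ with h | h
        · rwa [edgeX_self, ← edgeX_par hv] at h
        · exact absurd (h.2.trans (congrArg (fun w => (D w).2) h.1)) hpv.ne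

end RootedOrderedTree

/-! ### Hanging drawings and the linear morphs between stages. -/

namespace RootedOrderedTree

variable {V : Type*} {T : RootedOrderedTree V}

theorem linearMorph_apply (D E : Drawing V) (t : ℝ) (v : V) :
    D.linearMorph E t v = (1 - t) • D v + t • E v := rfl


theorem edgeX_congr {D E : Drawing V} {v : V} (h1 : D v = E v) (h2 : D (T.par v) = E (T.par v)) :
    T.edgeX D v = T.edgeX E v := by
  funext h; simp only [edgeX, h1, h2]

theorem span_congr {D E : Drawing V} {v : V} (h1 : D v = E v) (h2 : D (T.par v) = E (T.par v)) :
    T.span D v = T.span E v := by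
  simp only [span, h1, h2]

/-- In grid drawings each node drops by at least one row. -/
theorem snd_le_sub_one_of_isGrid {Γ : Drawing V} (hg : Γ.IsGrid)
    (hu : ∀ v, v ≠ T.root → (Γ v).2 < (Γ (T.par v)).2) (v : V) (hv : v ≠ T.root) :
    (Γ v).2 ≤ (Γ (T.par v)).2 - 1 := by
  have h := hu v hv
  obtain ⟨x, y, e⟩ := hg v
  obtain ⟨x', y', e'⟩ := hg (T.par v)
  rw [e, e'] at h ⊢
  simp only at h ⊢
  have : y + 1 ≤ y' := by exact_mod_cast h
  have : (y : ℝ) + 1 ≤ y' := by exact_mod_cast this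
  linarith

/-- In an ordered grid drawing, each node sees all points that lie one row below it and to the right
of the drawing, except past the edges on the right of the node. -/
theorem edgeX_lt_of_isGrid {Γ : Drawing V} (hg : Γ.IsGrid)
    (hu : ∀ v, v ≠ T.root → (Γ v).2 < (Γ (T.par v)).2) (ho : T.IsOrdered Γ) {R C : ℝ}
    (hR : ∀ v, (Γ v).1 ≤ R) (hC : R < C) {u a : V} (hl : T.LeftOf u a) {h : ℝ}
    (hh : h ∈ T.span Γ u) (h1 : (Γ a).2 - 1 ≤ h) (h2 : h ≤ (Γ a).2) :
    T.edgeX Γ u h < (Γ a).1 + ((Γ a).2 - h) * (C - (Γ a).1) := by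
  have hur := hl.left_ne_root
  have har := hl.right_ne_root
  have hbound : ∀ h' ∈ T.span Γ u, T.edgeX Γ u h' ≤ R :=
    fun h' hh' => edgeX_le (hu u hur) hh' (hR _) (hR _)
  rcases h1.eq_or_lt with rfl | h1
  · have := hbound _ hh
    linarith
  have htop : (Γ a).2 ∈ T.span Γ u → T.edgeX Γ u (Γ a).2 < (Γ a).1 := by
    intro hm
    have ha := hu a har
    rcases ho u a hl _ hm ⟨le_rfl, ha.le⟩ with h | h
    · rwa [edgeX_self] at h
    · exact absurd (h.2.trans (congrArg (fun w => (Γ w).2) h.1)) ha.ne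
  obtain ⟨xu, yu, eu⟩ := hg u
  obtain ⟨xp, yp, ep⟩ := hg (T.par u)
  obtain ⟨xa, ya, ea⟩ := hg a
  have hspan : T.span Γ u = Set.Icc (yu : ℝ) yp := by simp [span, eu, ep]
  have ea2 : (Γ a).2 = ya := by rw [ea]
  rw [hspan] at hh htop hbound
  rw [ea2] at h1 h2 htop ⊢
  -- By integrality the edge of `u` either has only the height `ya` in common with the strip between
  -- rows `ya - 1` and `ya`, or crosses the whole strip. In the latter case it is left of `a` on top
  -- and left of column `C` at the bottom, hence left of the segment between these points.
  have hp : ya ≤ yp := by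
    have : (ya : ℝ) - 1 < yp := h1.trans_le hh.2
    have : ya - 1 < yp := by exact_mod_cast this
    omega
  have hp' : (ya : ℝ) ≤ yp := by exact_mod_cast hp
  have hya : (yu : ℝ) ≤ ya := hh.1.trans h2
  have hya' : yu ≤ ya := by exact_mod_cast hya
  have ht := htop ⟨hya, hp'⟩
  rcases hya'.eq_or_lt with e | hlt
  · have : h = ya := le_antisymm h2 (e ▸ hh.1)
    rw [this]
    linarith
  · have hlt' : (yu : ℝ) ≤ ya - 1 := by
      have : yu ≤ ya - 1 := by omega
      exact_mod_cast this
    have hb := hbound (ya - 1) ⟨hlt', by linarith⟩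
    have e : h = (1 - (ya - h)) * ya + (ya - h) * (ya - 1) := by ring
    rw [e, edgeX_convex, ← e]
    have h3 := mul_pos (show 0 < 1 - (ya - h) by linarith) (sub_pos.2 ht)
    have h4 := mul_nonneg (sub_nonneg.2 h2) (sub_nonneg.2 (hb.trans hC.le))
    linarith

variable [Fintype V]

/-- A drawing in which the nodes that come after the `k`-th in preorder hang one row below their
parents, in columns that increase with the preorder and lie to the right of the other nodes, is
ordered if its restriction to the other nodes is, and if each of these nodes sees the points from
which children may hang. -/
theorem isOrdered_of_hanging {E : Drawing V} {k : ℕ} {R : ℝ}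
    (hang : ∀ v, k < T.rank v → E v = (R + T.rank v, (E (T.par v)).2 - 1))
    (hx : ∀ v, T.rank v ≤ k → (E v).1 ≤ R + k)
    (hy : ∀ v, v ≠ T.root → (E v).2 ≤ (E (T.par v)).2 - 1)
    (hord : ∀ u v, T.rank u ≤ k → T.rank v ≤ k → T.LeftOf u v →
      ∀ h ∈ T.span E u, h ∈ T.span E v →
        T.edgeX E u h < T.edgeX E v h ∨ (T.par u = T.par v ∧ h = (E (T.par u)).2))
    (hsee : ∀ u a, T.rank u ≤ k → T.rank a ≤ k → T.LeftOf u a → ∀ h ∈ T.span E u,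
      (E a).2 - 1 ≤ h → h ≤ (E a).2 →
        T.edgeX E u h < (E a).1 + ((E a).2 - h) * (R + (k + 1) - (E a).1)) :
    T.IsOrdered E := by
  have hD : ∀ v, v ≠ T.root → (E v).2 < (E (T.par v)).2 :=
    fun v hv => (hy v hv).trans_lt (sub_one_lt _)
  have hxlt : ∀ (w : V) (j : ℕ), k < j → T.rank w < j → (E w).1 < R + j := by
    intro w j hkj hwj
    have hkj' : (k : ℝ) < j := Nat.cast_lt.2 hkj
    have hwj' : (T.rank w : ℝ) < j := Nat.cast_lt.2 hwj
    rcases le_or_gt (T.rank w) k with h | h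
    · linarith [hx w h]
    · rw [hang w h]; simpa using hwj'
  intro u v huv h hhu hhv
  have hru := huv.rank_lt
  have hur := huv.left_ne_root
  have hvr := huv.right_ne_root
  rcases le_or_gt (T.rank v) k with hvk | hvk
  · exact hord u v (hru.le.trans hvk) hvk huv h hhu hhv
  have hpu := rank_par_lt hur
  have hpv := rank_par_lt hvr
  have ev := hang v hvk
  have ev1 : (E v).1 = R + T.rank v := by rw [ev]
  have ev2 : (E v).2 = (E (T.par v)).2 - 1 := by rw [ev]
  have xu : (E u).1 < (E v).1 := ev1 ▸ hxlt u _ hvk hru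
  have xpu : (E (T.par u)).1 < (E v).1 := ev1 ▸ hxlt _ _ hvk (hpu.trans hru)
  have xpv : (E (T.par v)).1 < (E v).1 := ev1 ▸ hxlt _ _ hvk hpv
  have huv' := huv.par_right
  rcases huv' with hl | hanc
  · left
    rcases le_or_gt (T.rank (T.par v)) k with ha | ha
    · have h1 : 0 ≤ h - (E v).2 := sub_nonneg.2 hhv.1
      have h2 := hsee u (T.par v) (hl.rank_lt.le.trans ha) ha hl h hhu (ev2 ▸ hhv.1) hhv.2
      refine h2.trans_le ?_
      have hk : (k : ℝ) + 1 ≤ T.rank v := by exact_mod_cast hvk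
      have h3 : T.edgeX E v h = (E (T.par v)).1 +
          ((E (T.par v)).2 - h) * (R + T.rank v - (E (T.par v)).1) := by
        rw [edgeX, ev2, ev1]
        field_simp
        ring
      rw [h3]
      have := hhv.2
      gcongr
    · have ea : (E (T.par v)).1 = R + T.rank (T.par v) := by rw [hang _ ha]
      have hul := hl.rank_lt
      have h1 : T.edgeX E u h < (E (T.par v)).1 :=
        ea ▸ edgeX_lt (hD u hur) hhu (hxlt _ _ ha hul) (hxlt _ _ ha (hpu.trans hul))
      exact h1.trans_le (le_edgeX (hD v hvr) hhv xpv.le le_rfl)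
  · by_cases hp : T.par u = T.par v
    · rcases hhu.2.eq_or_lt with he | hlt
      · exact Or.inr ⟨hp, he⟩
      left
      -- Since `v` is one row below the common parent and `u` at least one, `r ≤ s`: at equal
      -- heights `v` has at least the weight of `u`. Both `u` and the parent are left of `v`.
      obtain ⟨s, hs0, hs1, es, xs⟩ := exists_edgeX_eq (hD u hur) hhu
      obtain ⟨r, hr0, hr1, er, xr⟩ := exists_edgeX_eq (hD v hvr) hhv
      rw [xs, xr]
      have hyu := hy u hur
      rw [hp] at es hyu xpu hlt ⊢
      rw [ev2] at er
      have hsr : 1 - s ≤ 1 - r := by nlinarith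
      have hs : s < 1 := by
        refine hs1.lt_of_ne ?_
        rintro rfl
        rw [es] at hlt
        linarith
      nlinarith
    · left
      -- The parent of `u` is at least one row below that of `v`, so the edges can share only the
      -- row of `v`, where one has its top and the other its bottom.
      have h1 := hanc.snd_le_sub_one hy (Ne.symm hp)
      have h2 := hhu.2
      have h3 := hhv.1
      have e1 : h = (E (T.par u)).2 := by linarith
      have e2 : h = (E v).2 := by linarith
      calc T.edgeX E u h = (E (T.par u)).1 := by rw [e1, edgeX_par (hD u hur)]
        _ < (E v).1 := xpu
        _ = T.edgeX E v h := by rw [e2, edgeX_self]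

variable (T) in
open Classical in
/-- The drawing obtained from `Γ` by making all nodes but the root and the first `k` nodes in
preorder hang one row below their parents, in the columns that follow column `R`. -/
noncomputable def stage (Γ : Drawing V) (R : ℝ) (k : ℕ) (v : V) : ℝ × ℝ :=
  if h : T.rank v < k ∨ v = T.root then Γ v
  else (R + T.rank v, (stage Γ R k (T.par v)).2 - 1)
termination_by T.depth v
decreasing_by exact T.depth_par_lt fun e => h (Or.inr e)

theorem stage_of_lt {Γ : Drawing V} {R : ℝ} {k : ℕ} {v : V} (h : T.rank v < k) :
    T.stage Γ R k v = Γ v := by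
  rw [stage, dif_pos (Or.inl h)]

theorem stage_root {Γ : Drawing V} {R : ℝ} {k : ℕ} : T.stage Γ R k T.root = Γ T.root := by
  rw [stage, dif_pos (Or.inr rfl)]

theorem stage_of_le {Γ : Drawing V} {R : ℝ} {k : ℕ} {v : V} (hk : k ≤ T.rank v)
    (hv : v ≠ T.root) :
    T.stage Γ R k v = (R + T.rank v, (T.stage Γ R k (T.par v)).2 - 1) := by
  conv_lhs => rw [stage, dif_neg (not_or.2 ⟨hk.not_gt, hv⟩)]

theorem stage_card (Γ : Drawing V) (R : ℝ) : T.stage Γ R (Fintype.card V) = Γ :=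
  funext fun v => stage_of_lt (rank_lt_card v)

/-- A linear morph between consecutive stages is ordered. -/
theorem stage_step_isOrdered {Γ : Drawing V} (hg : Γ.IsGrid)
    (hu : ∀ v, v ≠ T.root → (Γ v).2 < (Γ (T.par v)).2) (ho : T.IsOrdered Γ) {R : ℝ}
    (hR : ∀ v, (Γ v).1 ≤ R) {k : ℕ} (hk : 1 ≤ k) {t : ℝ} (ht : t ∈ Set.Icc (0 : ℝ) 1)
    {E : Drawing V}
    (hE : E = Drawing.linearMorph (T.stage Γ R (k + 1)) (T.stage Γ R k) t) :
    (∀ v, v ≠ T.root → (E v).2 < (E (T.par v)).2) ∧ T.IsOrdered E := by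
  obtain ⟨ht0, ht1⟩ := ht
  have hne : ∀ v, k ≤ T.rank v → v ≠ T.root := by
    rintro v hv rfl
    rw [rank_root] at hv
    omega
  have hlt : ∀ v, T.rank v < k → E v = Γ v := by
    intro v hv
    rw [hE, linearMorph_apply, stage_of_lt hv, stage_of_lt (hv.trans (Nat.lt_succ_self k)),
      ← add_smul]
    simp
  have hang : ∀ v, k < T.rank v → E v = (R + T.rank v, (E (T.par v)).2 - 1) := by
    intro v hv
    rw [hE, linearMorph_apply, linearMorph_apply, stage_of_le hv.le (hne v hv.le),
      stage_of_le hv (hne v hv.le)]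
    ext <;> simp <;> ring
  have heq1 : ∀ v, T.rank v = k → (E v).1 = (1 - t) * (Γ v).1 + t * (R + k) := by
    intro v hv
    rw [hE, linearMorph_apply, stage_of_lt (hv.trans_lt (Nat.lt_succ_self k)),
      stage_of_le hv.ge (hne v hv.ge)]
    simp [hv]
  have heq2 : ∀ v, T.rank v = k →
      (E v).2 = (1 - t) * (Γ v).2 + t * ((Γ (T.par v)).2 - 1) := by
    intro v hv
    have := rank_par_lt (hne v hv.ge)
    rw [hE, linearMorph_apply, stage_of_lt (hv.trans_lt (Nat.lt_succ_self k)),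
      stage_of_le hv.ge (hne v hv.ge), stage_of_lt (this.trans_eq hv)]
    simp
  have hkpos : (1 : ℝ) ≤ k := by exact_mod_cast hk
  have hy1 := snd_le_sub_one_of_isGrid hg hu
  have hpar : ∀ v, v ≠ T.root → T.rank v ≤ k → E (T.par v) = Γ (T.par v) :=
    fun v hv h => hlt _ ((rank_par_lt hv).trans_le h)
  have hy : ∀ v, v ≠ T.root → (E v).2 ≤ (E (T.par v)).2 - 1 := by
    intro v hv
    rcases lt_trichotomy (T.rank v) k with h | h | h
    · rw [hpar v hv h.le, hlt v h]; exact hy1 v hv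
    · rw [hpar v hv h.le, heq2 v h]
      nlinarith [hy1 v hv]
    · rw [hang v h]
  have hD : ∀ v, v ≠ T.root → (E v).2 < (E (T.par v)).2 :=
    fun v hv => (hy v hv).trans_lt (sub_one_lt _)
  have hshift : ∀ v, T.rank v = k → (Γ v).2 ≤ (E v).2 ∧ (Γ v).1 ≤ (E v).1 ∧
      (E v).1 ≤ R + k := by
    intro v hv
    have h1 := hy1 v (hne v hv.ge)
    have h2 := hR v
    rw [heq2 v hv, heq1 v hv]
    refine ⟨?_, ?_, ?_⟩ <;> nlinarith
  -- The parent of the moving node is fixed. The slope of its edge is a mediant of the slopes at the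
  -- two ends of the move; the hanging one is at least the original one because `Γ` drops at least
  -- one row and column `R + k` is right of `Γ`.
  have hmove : ∀ v, T.rank v = k → ∀ h, h ≤ (Γ (T.par v)).2 →
      T.edgeX Γ v h ≤ T.edgeX E v h := by
    intro v hv h hh
    have hvr := hne v hv.ge
    have hp := hpar v hvr hv.le
    have h1 := hu v hvr
    have h2 := hD v hvr
    have h3 := hy1 v hvr
    rw [hp] at h2
    have e : ∀ D : Drawing V, D (T.par v) = Γ (T.par v) → (D v).2 < (Γ (T.par v)).2 →
        T.edgeX D v h = (Γ (T.par v)).1 +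
          ((D v).1 - (Γ (T.par v)).1) / ((Γ (T.par v)).2 - (D v).2) *
            ((Γ (T.par v)).2 - h) := by
      intro D hDp hw
      have := (sub_pos.2 hw).ne'
      unfold edgeX
      rw [hDp]
      field_simp
      ring
    rw [e Γ rfl h1, e E hp h2]
    have : ((Γ v).1 - (Γ (T.par v)).1) / ((Γ (T.par v)).2 - (Γ v).2) ≤
        ((E v).1 - (Γ (T.par v)).1) / ((Γ (T.par v)).2 - (E v).2) := by
      rw [div_le_div_iff₀ (sub_pos.2 h1) (sub_pos.2 h2), heq1 v hv, heq2 v hv]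
      have hA : 0 ≤ (R + k) - (Γ (T.par v)).1 := by linarith [hR (T.par v)]
      have hB : 0 ≤ (Γ (T.par v)).2 - (Γ v).2 - 1 := by linarith
      have hC := hR v
      have key : 0 ≤ t * (((Γ (T.par v)).2 - (Γ v).2) * ((R + k) - (Γ (T.par v)).1) -
          ((Γ v).1 - (Γ (T.par v)).1)) := by
        apply mul_nonneg ht0
        nlinarith
      nlinarith
    have := mul_le_mul_of_nonneg_right this (sub_nonneg.2 hh)
    linarith
  refine ⟨hD, isOrdered_of_hanging (k := k) (R := R) hang ?_ hy ?_ ?_⟩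
  · intro v hv
    rcases hv.lt_or_eq with h | h
    · rw [hlt v h]; linarith [hR v]
    · exact (hshift v h).2.2
  · intro u v huk hvk hl h hhu hhv
    have hur := hl.left_ne_root
    have hvr := hl.right_ne_root
    have huk' : T.rank u < k := hl.rank_lt.trans_le hvk
    have eu := hlt u huk'
    have epu := hpar u hur huk
    have epv := hpar v hvr hvk
    rw [span_congr eu epu] at hhu
    rw [edgeX_congr eu epu, epu]
    rcases hvk.lt_or_eq with hvk' | hvk'
    · have ev := hlt v hvk'
      rw [span_congr ev epv] at hhv
      rw [edgeX_congr ev epv]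
      exact ho u v hl h hhu hhv
    · have hhp : h ≤ (Γ (T.par v)).2 := epv ▸ hhv.2
      refine (ho u v hl h hhu ⟨(hshift v hvk').1.trans hhv.1, hhp⟩).imp_left fun hlt => ?_
      exact hlt.trans_le (hmove v hvk' h hhp)
  · intro u a huk hak hl h hhu h1 h2
    have hur := hl.left_ne_root
    have har := hl.right_ne_root
    have huk' : T.rank u < k := hl.rank_lt.trans_le hak
    have eu := hlt u huk'
    have epu := hpar u hur huk
    rw [span_congr eu epu] at hhu
    rw [edgeX_congr eu epu]
    rcases hak.lt_or_eq with hak' | hak'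
    · rw [hlt a hak'] at h1 h2 ⊢
      exact edgeX_lt_of_isGrid hg hu ho hR (by linarith) hl hhu h1 h2
    · obtain ⟨s1, s2, s3⟩ := hshift a hak'
      have epa := hpar a har hak
      -- The moving node `a` goes only up and right. Below its old row, the view from its old place
      -- suffices; above it, its old edge separates `u` from the new place of `a`.
      rcases le_total h (Γ a).2 with hh | hh
      · refine (edgeX_lt_of_isGrid hg hu ho hR (C := R + (k + 1)) (by linarith) hl hhu
          (by linarith) hh).trans_le ?_
        nlinarith
      · have hya := hy a har
        rw [epa] at hya
        have hha : h ∈ T.span Γ a := ⟨hh, by linarith⟩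
        have hlt1 : T.edgeX Γ u h < T.edgeX Γ a h := by
          rcases ho u a hl h hhu hha with h' | h'
          · exact h'
          · rw [h'.1] at h'
            linarith [h'.2]
        have hle : T.edgeX Γ a h ≤ (E a).1 := by
          obtain ⟨s, hs0, hs1, e⟩ := exists_convex hh h2
          rw [e, edgeX_convex, edgeX_self]
          have := hmove a hak' (E a).2 (by linarith)
          rw [edgeX_self] at this
          nlinarith
        nlinarith

/-- The linear morph between the drawings in which all nodes but the root hang is ordered. -/
theorem stage_one_isOrdered {Γ Γ' : Drawing V} {R R' : ℝ} (hR : (Γ T.root).1 ≤ R)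
    (hR' : (Γ' T.root).1 ≤ R') {t : ℝ} (ht : t ∈ Set.Icc (0 : ℝ) 1) {E : Drawing V}
    (hE : E = Drawing.linearMorph (T.stage Γ R 1) (T.stage Γ' R' 1) t) :
    (∀ v, v ≠ T.root → (E v).2 < (E (T.par v)).2) ∧ T.IsOrdered E := by
  obtain ⟨ht0, ht1⟩ := ht
  -- Both ends obey the same affine rule, so the interpolation hangs too, with base column `(1 - t)
  -- * R + t * R'`. With `k = 0` only the root is not hanging, and the conditions on pairs are void.
  have hang : ∀ v, v ≠ T.root →
      E v = ((1 - t) * R + t * R' + T.rank v, (E (T.par v)).2 - 1) := by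
    intro v hv
    have := rank_pos hv
    rw [hE, linearMorph_apply, linearMorph_apply, stage_of_le this hv, stage_of_le this hv]
    ext <;> simp <;> ring
  have hne : ∀ v, 0 < T.rank v → v ≠ T.root := by
    rintro v hv rfl
    simp at hv
  have hy : ∀ v, v ≠ T.root → (E v).2 ≤ (E (T.par v)).2 - 1 := by
    intro v hv; rw [hang v hv]
  refine ⟨fun v hv => (hy v hv).trans_lt (sub_one_lt _),
    isOrdered_of_hanging (k := 0) (R := (1 - t) * R + t * R') (fun v hv => hang v (hne v hv))
      ?_ hy ?_ ?_⟩
  · intro v hv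
    have : v = T.root := by
      by_contra h
      exact absurd (rank_pos h) (not_lt.2 hv)
    rw [this, hE, linearMorph_apply, stage_root, stage_root]
    simp
    nlinarith
  · intro u v _ hv hl
    exact absurd (hl.rank_lt.trans_le hv) (Nat.not_lt_zero _)
  · intro u v _ hv hl
    exact absurd (hl.rank_lt.trans_le hv) (Nat.not_lt_zero _)

end RootedOrderedTree

/-! ### Widths and heights as differences of extreme coordinates. -/

theorem Drawing.ncard_extent {V : Type*} [Finite V] {f : V → ℝ} (hf : ∀ v, ∃ k : ℤ, f v = k)
    {u v : V} (hu : ∀ w, f u ≤ f w) (hv : ∀ w, f w ≤ f v) :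
    (({k : ℤ | ⨅ w, f w ≤ k ∧ k ≤ ⨆ w, f w}.ncard : ℕ) : ℝ) = f v - f u + 1 := by
  have : Nonempty V := ⟨u⟩
  have hinf : ⨅ w, f w = f u :=
    le_antisymm (ciInf_le (Set.finite_range f).bddBelow u) (le_ciInf hu)
  have hsup : ⨆ w, f w = f v :=
    le_antisymm (ciSup_le hv) (le_ciSup (Set.finite_range f).bddAbove v)
  have huv := hu v
  rw [hinf, hsup]
  obtain ⟨a, ha⟩ := hf u
  obtain ⟨b, hb⟩ := hf v
  rw [ha, hb] at huv ⊢
  have hab : a ≤ b := by exact_mod_cast huv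
  have : {k : ℤ | (a : ℝ) ≤ k ∧ (k : ℝ) ≤ b} = (Finset.Icc a b : Finset ℤ) := by
    ext k; simp
  rw [this, Set.ncard_coe_finset, Int.card_Icc]
  have h : ((b + 1 - a).toNat : ℤ) = b + 1 - a := Int.toNat_of_nonneg (by omega)
  have h' : (((b + 1 - a).toNat : ℤ) : ℝ) = ((b + 1 - a : ℤ) : ℝ) := congrArg _ h
  push_cast at h'
  rw [h']
  ring

namespace Drawing

variable {V : Type*} [Finite V] {Γ : Drawing V}

theorem iInf_le_iSup_of_finite [Nonempty V] (f : V → ℝ) : ⨅ v, f v ≤ ⨆ v, f v :=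
  ciInf_le_ciSup (Set.finite_range f).bddBelow (Set.finite_range f).bddAbove

theorem width_eq (hg : Γ.IsGrid) {u v : V} (hu : ∀ w, (Γ u).1 ≤ (Γ w).1)
    (hv : ∀ w, (Γ w).1 ≤ (Γ v).1) : (Γ.width : ℝ) = (Γ v).1 - (Γ u).1 + 1 := by
  have : Nonempty V := ⟨u⟩
  rw [← ncard_extent (f := fun w => (Γ w).1) (fun w => ?_) hu hv, width]
  · congr 2
    ext k
    simp only [boundingBox, Set.mem_Icc, Prod.mk_le_mk, Set.mem_ofPred_eq]
    exact ⟨fun ⟨_, h⟩ => ⟨h.1.1, h.2.1⟩,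
      fun h => ⟨_, ⟨h.1, le_rfl⟩, h.2, iInf_le_iSup_of_finite _⟩⟩
  · obtain ⟨x, y, e⟩ := hg w
    exact ⟨x, by rw [e]⟩

theorem height_eq (hg : Γ.IsGrid) {u v : V} (hu : ∀ w, (Γ u).2 ≤ (Γ w).2)
    (hv : ∀ w, (Γ w).2 ≤ (Γ v).2) : (Γ.height : ℝ) = (Γ v).2 - (Γ u).2 + 1 := by
  have : Nonempty V := ⟨u⟩
  rw [← ncard_extent (f := fun w => (Γ w).2) (fun w => ?_) hu hv, height]
  · congr 2
    ext k
    simp only [boundingBox, Set.mem_Icc, Prod.mk_le_mk, Set.mem_ofPred_eq]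
    exact ⟨fun ⟨_, h⟩ => ⟨h.1.2, h.2.2⟩,
      fun h => ⟨_, ⟨le_rfl, h.1⟩, iInf_le_iSup_of_finite _, h.2⟩⟩
  · obtain ⟨x, y, e⟩ := hg w
    exact ⟨y, by rw [e]⟩

theorem width_le [Nonempty V] (hg : Γ.IsGrid) {a b : ℝ} (ha : ∀ w, a ≤ (Γ w).1)
    (hb : ∀ w, (Γ w).1 ≤ b) : (Γ.width : ℝ) ≤ b - a + 1 := by
  obtain ⟨u, hu⟩ := Finite.exists_min fun w => (Γ w).1
  obtain ⟨v, hv⟩ := Finite.exists_max fun w => (Γ w).1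
  rw [width_eq hg hu hv]
  linarith [ha u, hb v]

theorem height_le [Nonempty V] (hg : Γ.IsGrid) {a b : ℝ} (ha : ∀ w, a ≤ (Γ w).2)
    (hb : ∀ w, (Γ w).2 ≤ b) : (Γ.height : ℝ) ≤ b - a + 1 := by
  obtain ⟨u, hu⟩ := Finite.exists_min fun w => (Γ w).2
  obtain ⟨v, hv⟩ := Finite.exists_max fun w => (Γ w).2
  rw [height_eq hg hu hv]
  linarith [ha u, hb v]

omit [Finite V] in
theorem linearMorph_symm (Γ Γ' : Drawing V) (t : ℝ) :
    Γ.linearMorph Γ' t = Γ'.linearMorph Γ (1 - t) := by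
  funext v
  simp only [linearMorph, sub_sub_cancel]
  exact add_comm _ _

end Drawing

/-! ### Size of the stages and assembly of the morph. -/

namespace RootedOrderedTree

variable {V : Type*} {T : RootedOrderedTree V} [Fintype V] {Γ : Drawing V}

theorem stage_cases (Γ : Drawing V) (R : ℝ) (k : ℕ) (v : V) :
    ((T.rank v < k ∨ v = T.root) ∧ T.stage Γ R k v = Γ v) ∨
      (v ≠ T.root ∧ T.stage Γ R k v = (R + T.rank v, (T.stage Γ R k (T.par v)).2 - 1)) := by
  by_cases hv : v = T.root
  · exact Or.inl ⟨Or.inr hv, by rw [hv, stage_root]⟩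
  · rcases lt_or_ge (T.rank v) k with h | h
    · exact Or.inl ⟨Or.inl h, stage_of_lt h⟩
    · exact Or.inr ⟨hv, stage_of_le h hv⟩

theorem stage_isGrid (hg : Γ.IsGrid) (R : ℤ) (k : ℕ) :
    Drawing.IsGrid (T.stage Γ R k) := by
  intro v
  induction v using T.par_induction with
  | root => rw [stage_root]; exact hg _
  | step v hv ih =>
    rcases stage_cases (T := T) Γ R k v with ⟨-, h⟩ | ⟨-, h⟩
    · rw [h]; exact hg v
    · obtain ⟨x, y, e⟩ := ih
      exact ⟨R + T.rank v, y - 1, by rw [h, e]; push_cast; rfl⟩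

/-- Hanging loses exactly one row per edge where `Γ` loses at least one, so no node sinks below its
place in `Γ`. -/
theorem le_stage_snd (hy : ∀ v, v ≠ T.root → (Γ v).2 ≤ (Γ (T.par v)).2 - 1) (R : ℝ) (k : ℕ)
    (v : V) : (Γ v).2 ≤ (T.stage Γ R k v).2 := by
  induction v using T.par_induction with
  | root => rw [stage_root]
  | step v hv ih =>
    rcases stage_cases (T := T) Γ R k v with ⟨-, h⟩ | ⟨-, h⟩
    · rw [h]
    · rw [h]; exact (hy v hv).trans (by simpa using ih)

theorem stage_snd_le {b : ℝ} (hb : ∀ v, (Γ v).2 ≤ b) (R : ℝ) (k : ℕ) (v : V) :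
    (T.stage Γ R k v).2 ≤ b := by
  induction v using T.par_induction with
  | root => rw [stage_root]; exact hb _
  | step v hv ih =>
    rcases stage_cases (T := T) Γ R k v with ⟨-, h⟩ | ⟨-, h⟩
    · rw [h]; exact hb v
    · rw [h]; exact (sub_le_self _ zero_le_one).trans ih

theorem height_stage_le (hg : Γ.IsGrid)
    (hu : ∀ v, v ≠ T.root → (Γ v).2 < (Γ (T.par v)).2) (R : ℤ) (k : ℕ) :
    Drawing.height (T.stage Γ R k) ≤ Γ.height := by
  have : Nonempty V := ⟨T.root⟩
  obtain ⟨u, hmin⟩ := Finite.exists_min fun w => (Γ w).2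
  obtain ⟨v, hmax⟩ := Finite.exists_max fun w => (Γ w).2
  have h1 := Drawing.height_eq hg hmin hmax
  have h2 := Drawing.height_le (stage_isGrid (T := T) hg R k)
    (fun w => (hmin w).trans (le_stage_snd (snd_le_sub_one_of_isGrid hg hu) R k w))
    (stage_snd_le hmax R k)
  rw [← h1] at h2
  exact_mod_cast h2

/-- If `W` is at least the width of `Γ`, then there is a column to the right of which the nodes can
hang such that the width of the stages is at most `W + (n - 1)` and, for `n ≥ 2`, this value is
attained. -/
theorem exists_width_stage (hg : Γ.IsGrid) {W : ℕ} (hW : Γ.width ≤ W) :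
    ∃ R : ℤ, (∀ v, (Γ v).1 ≤ R) ∧
      (∀ k, k ≤ Fintype.card V →
        Drawing.width (T.stage Γ R k) ≤ W + (Fintype.card V - 1)) ∧
      (2 ≤ Fintype.card V → Drawing.width (T.stage Γ R (Fintype.card V - 1)) =
        W + (Fintype.card V - 1)) := by
  classical
  have : Nonempty V := ⟨T.root⟩
  set n := Fintype.card V with hn
  have hn1 : 1 ≤ n := Fintype.card_pos
  -- The last node in preorder is left out because it hangs in every stage `k < n` when `n ≥ 2`; the
  -- leftmost column of the others is then that of stage `n - 1`. The root is kept for `n = 1`.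
  -- Taking `R = x + W - 1` gives exactly `W` columns from `x` to `R`, and at most `n - 1` more for
  -- the hanging nodes.
  obtain ⟨m, hm, hmin⟩ := Finset.exists_min_image
    (Finset.univ.filter fun v => T.rank v < n - 1 ∨ v = T.root) (fun v => (Γ v).1)
    ⟨T.root, by simp⟩
  simp only [Finset.mem_filter, Finset.mem_univ, true_and] at hm hmin
  obtain ⟨x, y, e⟩ := hg m
  have em : (Γ m).1 = x := by rw [e]
  rw [em] at hmin
  have hR : ∀ v, (Γ v).1 ≤ ((x + W - 1 : ℤ) : ℝ) := by
    obtain ⟨p, hp⟩ := Finite.exists_min fun w => (Γ w).1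
    obtain ⟨q, hq⟩ := Finite.exists_max fun w => (Γ w).1
    have h1 := Drawing.width_eq hg hp hq
    have h2 : (Γ.width : ℝ) ≤ W := Nat.cast_le.2 hW
    have h3 := hp m
    intro v
    have h4 := hq v
    push_cast
    linarith
  have hRm := hR m
  have hlow : ∀ k, k < n → ∀ v, (x : ℝ) ≤ (T.stage Γ (x + W - 1 : ℤ) k v).1 := by
    intro k hk v
    rcases stage_cases (T := T) Γ (x + W - 1 : ℤ) k v with ⟨h', h⟩ | ⟨-, h⟩
    · rw [h]; exact hmin v (h'.imp_left fun h => by omega)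
    · rw [h]
      have : (0 : ℝ) ≤ T.rank v := Nat.cast_nonneg _
      linarith
  have hhigh : ∀ k v, (T.stage Γ (x + W - 1 : ℤ) k v).1 ≤ (x + W - 1 : ℤ) + ((n - 1 : ℕ) : ℝ) := by
    intro k v
    rcases stage_cases (T := T) Γ (x + W - 1 : ℤ) k v with ⟨h', h⟩ | ⟨-, h⟩
    · rw [h]
      have : (0 : ℝ) ≤ (n - 1 : ℕ) := Nat.cast_nonneg _
      linarith [hR v]
    · rw [h]
      have : T.rank v ≤ n - 1 := Nat.le_sub_one_of_lt (rank_lt_card v)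
      have : (T.rank v : ℝ) ≤ (n - 1 : ℕ) := Nat.cast_le.2 this
      simpa using this
  refine ⟨x + W - 1, hR, ?_, ?_⟩
  · intro k hk
    rcases hk.lt_or_eq with hk | rfl
    · have := Drawing.width_le (stage_isGrid (T := T) hg (x + W - 1) k) (hlow k hk) (hhigh k)
      have h' : (Drawing.width (T.stage Γ (x + W - 1 : ℤ) k) : ℝ) ≤ ((W + (n - 1) : ℕ) : ℝ) := by
        refine this.trans (le_of_eq ?_)
        push_cast
        ring
      exact_mod_cast h'
    · rw [stage_card]
      exact hW.trans (Nat.le_add_right _ _)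
  · intro hn2
    obtain ⟨l, hl⟩ := exists_rank_eq (T := T) (k := n - 1) (by omega)
    have hlr : l ≠ T.root := by
      rintro rfl
      rw [rank_root] at hl
      omega
    have el : (T.stage Γ (x + W - 1 : ℤ) (n - 1) l).1 = (x + W - 1 : ℤ) + ((n - 1 : ℕ) : ℝ) := by
      rw [stage_of_le hl.ge hlr, hl]
    have em' : (T.stage Γ (x + W - 1 : ℤ) (n - 1) m).1 = x := by
      rcases hm with h | rfl
      · rw [stage_of_lt h, em]
      · rw [stage_root, em]
    have := Drawing.width_eq (stage_isGrid (T := T) hg (x + W - 1) (n - 1)) (u := m) (v := l)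
      (fun w => em' ▸ hlow _ (by omega) w) (fun w => el ▸ hhigh _ w)
    have h' : (Drawing.width (T.stage Γ (x + W - 1 : ℤ) (n - 1)) : ℝ) =
        ((W + (n - 1) : ℕ) : ℝ) := by
      rw [this, el, em']
      push_cast
      ring
    exact_mod_cast h'

/-- The sequence of drawings of the morph: make the nodes hang, in reverse preorder, then move the
root, and put the nodes into their final positions, in preorder. -/
theorem exists_morph_sequence {n : ℕ} (hn : Fintype.card V = n) {Γ₀ Γ₁ : Drawing V}
    (hgrid₀ : Γ₀.IsGrid) (hup₀ : ∀ v, v ≠ T.root → (Γ₀ v).2 < (Γ₀ (T.par v)).2)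
    (hord₀ : T.IsOrdered Γ₀) (hgrid₁ : Γ₁.IsGrid)
    (hup₁ : ∀ v, v ≠ T.root → (Γ₁ v).2 < (Γ₁ (T.par v)).2) (hord₁ : T.IsOrdered Γ₁) :
    ∃ F : ℕ → Drawing V, F 0 = Γ₀ ∧ F (2 * n - 1) = Γ₁ ∧
      (∀ i ≤ 2 * n - 1, (F i).IsGrid ∧ (F i).height ≤ max Γ₀.height Γ₁.height ∧
        (F i).width ≤ max Γ₀.width Γ₁.width + (n - 1)) ∧
      (∀ i < 2 * n - 1, ∀ t ∈ Set.Icc (0 : ℝ) 1,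
        ((F i).linearMorph (F (i + 1)) t).IsStrictlyUpward T ∧
          ((F i).linearMorph (F (i + 1)) t).IsPlanar T) ∧
      (2 ≤ n → (F 1).width = max Γ₀.width Γ₁.width + (n - 1)) := by
  have : Nonempty V := ⟨T.root⟩
  have hn1 : 1 ≤ n := hn ▸ Fintype.card_pos
  have hcard : ∀ Γ R, T.stage Γ R n = Γ := hn ▸ stage_card
  obtain ⟨R₀, hR₀, hle₀, heq₀⟩ :=
    exists_width_stage (T := T) hgrid₀ (le_max_left Γ₀.width Γ₁.width)
  obtain ⟨R₁, hR₁, hle₁, -⟩ :=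
    exists_width_stage (T := T) hgrid₁ (le_max_right Γ₀.width Γ₁.width)
  rw [hn] at hle₀ heq₀ hle₁
  -- Index `n - 1` is stage 1 of `Γ₀` and index `n` is stage 1 of `Γ₁`; stage 1 is already
  -- canonical, since the root has rank 0.
  refine ⟨fun i => if i < n then T.stage Γ₀ R₀ (n - i) else T.stage Γ₁ R₁ (i - n + 1),
    ?_, ?_, ?_, ?_, ?_⟩
  · dsimp only
    rw [if_pos (by omega), Nat.sub_zero, hcard]
  · dsimp only
    rw [if_neg (by omega), show 2 * n - 1 - n + 1 = n by omega, hcard]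
  · intro i hi
    dsimp only
    split_ifs
    · exact ⟨stage_isGrid hgrid₀ _ _,
        (height_stage_le hgrid₀ hup₀ _ _).trans (le_max_left _ _), hle₀ _ (by omega)⟩
    · exact ⟨stage_isGrid hgrid₁ _ _,
        (height_stage_le hgrid₁ hup₁ _ _).trans (le_max_right _ _), hle₁ _ (by omega)⟩
  · intro i hi t ht
    dsimp only
    suffices h : ∀ E, E = Drawing.linearMorph
        (if i < n then T.stage Γ₀ R₀ (n - i) else T.stage Γ₁ R₁ (i - n + 1))
        (if i + 1 < n then T.stage Γ₀ R₀ (n - (i + 1)) else T.stage Γ₁ R₁ (i + 1 - n + 1)) t →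
        (∀ v, v ≠ T.root → (E v).2 < (E (T.par v)).2) ∧ T.IsOrdered E from
      ⟨isStrictlyUpward_iff.2 (h _ rfl).1, (h _ rfl).2.isPlanar (h _ rfl).1⟩
    intro E hE
    rcases lt_trichotomy (i + 1) n with h | h | h
    · rw [if_pos (by omega), if_pos h, show n - i = n - (i + 1) + 1 by omega] at hE
      exact stage_step_isOrdered hgrid₀ hup₀ hord₀ hR₀ (by omega) ht hE
    · rw [if_pos (by omega), if_neg (by omega), show n - i = 1 by omega,
        show i + 1 - n + 1 = 1 by omega] at hE
      exact stage_one_isOrdered (hR₀ _) (hR₁ _) ht hE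
    · rw [if_neg (by omega), if_neg (by omega), Drawing.linearMorph_symm,
        show i + 1 - n + 1 = i - n + 1 + 1 by omega] at hE
      exact stage_step_isOrdered hgrid₁ hup₁ hord₁ hR₁ (by omega)
        ⟨by linarith [ht.2], by linarith [ht.1]⟩ hE
  · intro h2
    dsimp only
    rw [if_pos (by omega)]
    exact heq₀ h2

end RootedOrderedTree

theorem Morph.height_le {V : Type*} {k : ℕ} (Δ : Morph V k) (i : Fin (k + 1)) :
    (Δ i).height ≤ Δ.height :=
  Finset.le_sup (f := fun i => (Δ i).height) (Finset.mem_univ i)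

theorem Morph.width_le {V : Type*} {k : ℕ} (Δ : Morph V k) (i : Fin (k + 1)) :
    (Δ i).width ≤ Δ.width :=
  Finset.le_sup (f := fun i => (Δ i).width) (Finset.mem_univ i)

open RootedOrderedTree in
theorem mainTheorem2 {V : Type*} [Fintype V] (n : ℕ) (hn : Fintype.card V = n)
    (T : RootedOrderedTree V) (Γ₀ Γ₁ : Drawing V)
    (hgrid₀ : Γ₀.IsGrid) (hplanar₀ : Γ₀.IsPlanar T)
    (hup₀ : Γ₀.IsStrictlyUpward T) (hord₀ : Γ₀.IsOrderPreserving T)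
    (hgrid₁ : Γ₁.IsGrid) (hplanar₁ : Γ₁.IsPlanar T)
    (hup₁ : Γ₁.IsStrictlyUpward T) (hord₁ : Γ₁.IsOrderPreserving T) :
    ∃ Δ : Morph V (2 * n - 1),
      Δ 0 = Γ₀ ∧ Δ (Fin.last (2 * n - 1)) = Γ₁ ∧
      (∀ i, (Δ i).IsGrid) ∧
      Δ.IsPlanar T ∧ Δ.IsUpward T ∧
      Δ.height = max Γ₀.height Γ₁.height ∧
      Δ.width = max Γ₀.width Γ₁.width + (n - 1) := by
  have hup₀' := isStrictlyUpward_iff.1 hup₀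
  have hup₁' := isStrictlyUpward_iff.1 hup₁
  obtain ⟨F, hF0, hFl, hF, hstep, hattain⟩ := exists_morph_sequence hn
    hgrid₀ hup₀' (isOrdered_of_isPlanar hup₀' hplanar₀ hord₀)
    hgrid₁ hup₁' (isOrdered_of_isPlanar hup₁' hplanar₁ hord₁)
  have hn1 : 1 ≤ n := hn ▸ Fintype.card_pos_iff.2 ⟨T.root⟩
  obtain ⟨Δ, hΔ⟩ : ∃ Δ : Morph V (2 * n - 1), ∀ i, Δ i = F i := ⟨fun i => F i, fun _ => rfl⟩
  have hfirst : Δ 0 = Γ₀ := by rw [hΔ, Fin.val_zero, hF0]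
  have hlast : Δ (Fin.last _) = Γ₁ := by rw [hΔ, Fin.val_last, hFl]
  have hbound : ∀ i, (Δ i).IsGrid ∧ (Δ i).height ≤ max Γ₀.height Γ₁.height ∧
      (Δ i).width ≤ max Γ₀.width Γ₁.width + (n - 1) :=
    fun i => hΔ i ▸ hF i (Nat.le_of_lt_succ i.2)
  refine ⟨Δ, hfirst, hlast, fun i => (hbound i).1, fun i t ht => ?_, fun i t ht => ?_,
    le_antisymm (Finset.sup_le fun i _ => (hbound i).2.1) ?_,
    le_antisymm (Finset.sup_le fun i _ => (hbound i).2.2) ?_⟩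
  · rw [hΔ, hΔ]
    exact (hstep i i.2 t ht).2
  · rw [hΔ, hΔ]
    exact (hstep i i.2 t ht).1
  · have h0 := Δ.height_le 0
    have hl := Δ.height_le (Fin.last _)
    rw [hfirst] at h0
    rw [hlast] at hl
    exact max_le h0 hl
  -- For `n = 1` nothing hangs and the end drawings attain the width; otherwise `Δ 1`, where just
  -- the last node hangs, attains it.
  · rcases hn1.eq_or_lt with h1 | h2
    · have h0 := Δ.width_le 0
      have hl := Δ.width_le (Fin.last _)
      rw [hfirst] at h0
      rw [hlast] at hl
      have := max_le h0 hl
      omega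
    · have h := Δ.width_le ⟨1, by omega⟩
      rw [hΔ, hattain h2] at h
      exact h
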